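/- Conventions. A category $\mathcal{A}$ is \emph{semi-abelian} if it has a zero object, is Barr exact (it is regular, with finite limits, and every internal equivalence relation is a kernel pair), is Bourn protomodular (equivalently here, the Short Five Lemma for regular epimorphisms holds) and has binary coproducts. It has \emph{enough projectives} if every object $A$ admits a regular epimorphism $P\to A$ with $P$ projective with respect to regular epimorphisms. A \emph{Birkhoff subcategory} $\mathcal{B}$ of $\mathcal{A}$ is a full reflective subcategory closed under subobjects and regular quotients; let $b\colon\mathcal{A}\to\mathcal{B}$ be the reflector, with unit $\eta$. An object $X$ is \emph{$\mathcal{B}$-perfect} if $b(X)=0$. A regular epimorphism $f\colon X\to A$ is a \emph{$\mathcal{B}$-trivial extension} if the naturality square $\eta_A\circ f=b(f)\circ\eta_X$ is a pullback, and a \emph{$\mathcal{B}$-central extension} of $A$ if there is a regular epimorphism $g\colon Y\to A$ such that the pullback $g^*(f)$ is a $\mathcal{B}$-trivial extension. A \emph{universal $\mathcal{B}$-central extension} of $A$ is an initial object of the full subcategory of the slice category $\mathcal{A}\downarrow A$ whose objects are the $\mathcal{B}$-central extensions of $A$. Proposition. Let $\mathcal{A}$ be a semi-abelian category with enough projectives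 and $\mathcal{B}$ a Birkhoff subcategory of $\mathcal{A}$. If $f\colon B\to A$ is a $\mathcal{B}$-central extension with $\mathcal{B}$-perfect domain $B$, then $f$ is a regular quotient of a universal $\mathcal{B}$-central extension of $A$: there exist a universal $\mathcal{B}$-central extension $u\colon U\to A$ and a regular epimorphism $q\colon U\to B$ in $\mathcal{A}$ with $f\circ q=u$. -/

import Mathlib

open CategoryTheory Limits

universe v u

namespace UCE

section SemiAbelian

variable (C : Type u) [Category.{v} C]

/-- A Barr exact category: a regular category (with finite limits) in which every internal
equivalence relation is effective, i.e. is the kernel pair of its coequalizer. -/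
class BarrExact : Prop extends Regular C where
  isEffective {R X : C} (p₁ p₂ : R ⟶ X) :
    IsEquivalenceRelation p₁ p₂ → IsEffectiveEquivalenceRelation p₁ p₂

/-- Bourn protomodularity of a pointed regular category: the (Regular) Short Five Lemma holds.
Here `kernel.map f' f b a w` is the morphism `k : Ker f' ⟶ Ker f` induced by the commutative
square `f' ≫ a = b ≫ f`. -/
class Protomodular [Regular C] [HasZeroMorphisms C] : Prop where
  shortFive {B' A' B A : C} (f' : B' ⟶ A') (f : B ⟶ A) (b : B' ⟶ B) (a : A' ⟶ A)
    (w : f' ≫ a = b ≫ f) :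
    IsRegularEpi f' → IsRegularEpi f → IsIso (kernel.map f' f b a w) → IsIso a → IsIso b

/-- A semi-abelian category: pointed, Barr exact, Bourn protomodular, with binary coproducts.
(The zero morphisms of a category with a zero object are unique.) -/
class SemiAbelian [HasZeroMorphisms C] : Prop extends
    BarrExact C, Protomodular C where
  hasZeroObject : HasZeroObject C
  hasBinaryCoproducts : HasBinaryCoproducts C

variable {C} in
/-- Projectivity with respect to regular epimorphisms. (Mathlib's `Projective` uses all
epimorphisms, which need not be regular here.) -/
def RegularProjective (P : C) : Prop :=
  ∀ ⦃X Y : C⦄ (e : X ⟶ Y) (g : P ⟶ Y), IsRegularEpi e → ∃ h : P ⟶ X, h ≫ e = g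

/-- Every object is the codomain of a regular epimorphism with (regular) projective domain. -/
class EnoughRegularProjectives : Prop where
  presentation (A : C) : ∃ (P : C) (p : P ⟶ A), RegularProjective P ∧ IsRegularEpi p

end SemiAbelian

section Birkhoff

variable {C : Type u} [Category.{v} C]

/-- A Birkhoff subcategory, given by its class `B` of objects: a full reflective subcategory,
closed under subobjects and regular quotients. -/
class Birkhoff (B : ObjectProperty C) extends Reflective B.ι where
  closedUnderSubobjects : B.IsClosedUnderSubobjects
  closedUnderRegularQuotients {X Y : C} (q : X ⟶ Y) : IsRegularEpi q → B X → B Y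

variable (B : ObjectProperty C) [Birkhoff B]

/-- The component `η_X : X ⟶ b X` of the unit of the reflection. -/
def unit (X : C) : X ⟶ ((reflector B.ι).obj X).obj :=
  (reflectorAdjunction B.ι).unit.app X

/-- An object is `B`-perfect when its reflection is a zero object of `B`. -/
def IsPerfect (X : C) : Prop := IsZero ((reflector B.ι).obj X)

/-- A `B`-trivial extension: a regular epimorphism whose naturality square for the unit of the
reflection is a pullback. -/
def IsTrivialExtension {X A : C} (f : X ⟶ A) : Prop :=
  IsRegularEpi f ∧
    IsPullback f (unit B X) (unit B A) (B.ι.map ((reflector B.ι).map f))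

/-- A `B`-central extension: a regular epimorphism `f` whose pullback along some regular
epimorphism `g` is a `B`-trivial extension. -/
def IsCentralExtension [HasPullbacks C] {X A : C} (f : X ⟶ A) : Prop :=
  IsRegularEpi f ∧
    ∃ (Y : C) (g : Y ⟶ A), IsRegularEpi g ∧ IsTrivialExtension B (pullback.snd f g)

/-- The objects of the slice category over `A` that are `B`-central extensions. -/
def centralExtensions [HasPullbacks C] (A : C) : ObjectProperty (Over A) :=
  fun X => IsCentralExtension B X.hom

/-- The category of `B`-central extensions of `A`, a full subcategory of the slice category. -/
abbrev Centr [HasPullbacks C] (A : C) := (centralExtensions B A).FullSubcategory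

/-- A universal `B`-central extension of `A`: an initial object of `Centr B A`. -/
def IsUniversalCentralExtension [HasPullbacks C] {U A : C} (u : U ⟶ A) : Prop :=
  ∃ hu : IsCentralExtension B u, Nonempty (IsInitial (⟨Over.mk u, hu⟩ : Centr B A))

end Birkhoff

end UCE

namespace UCE

/-! Write `[X]` for the kernel of the unit at `X`. The functor `[-]` preserves regular epimorphisms,
and a regular epimorphism is central exactly when any two maps it identifies agree on commutators
(`EqualizesCommutators`). Take a projective cover `P` of the domain `X` of `f` and let `F` be the
universal central quotient of `P` over `A` (`exists_centralization`). By projectivity, `F` maps to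
every central extension of `A`, though not uniquely. Restricting to `U = [F]` gives uniqueness: two
maps over `A` from `U` to a central extension agree on `[U]`, and `[U]` covers `U`
(`EqualizesCommutators.isRegularEpi_commutatorι`). Perfectness of `X` means `[X] = X`, so `F ⟶ X`
restricts to a regular epimorphism `U ⟶ X`, and `U` still covers `A`. -/

theorem exists_lift_of_isRegularEpi {C : Type u} [Category.{v} C] {X A S Y : C} (f : X ⟶ A)
    (hf : IsRegularEpi f) (m : S ⟶ Y) [Mono m] (g : X ⟶ S) (k : A ⟶ Y) (w : g ≫ m = f ≫ k) :
    ∃ r : A ⟶ S, f ≫ r = g ∧ r ≫ m = k := by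
  have sq : CommSq g f m k := ⟨w⟩
  exact ⟨sq.lift, sq.fac_left, sq.fac_right⟩

attribute [local simp] pullback.lift_fst pullback.lift_snd pullback.lift_fst_assoc
  pullback.lift_snd_assoc prod.lift_fst prod.lift_snd prod.lift_fst_assoc prod.lift_snd_assoc

/-! ### Images in regular categories. -/

section Regular

variable {C : Type u} [Category.{v} C] [Regular C]

theorem isRegularEpi_comp {X Y Z : C} (f : X ⟶ Y) (g : Y ⟶ Z) (hf : IsRegularEpi f)
    (hg : IsRegularEpi g) : IsRegularEpi (f ≫ g) :=
  inferInstance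

theorem isRegularEpi_of_comp {X Y Z : C} (f : X ⟶ Y) (g : Y ⟶ Z) (h : IsRegularEpi (f ≫ g)) :
    IsRegularEpi g := by
  have : StrongEpi g := strongEpi_of_strongEpi f g
  infer_instance

theorem exists_regularEpi_mono_factorization {X Y : C} (f : X ⟶ Y) :
    ∃ (I : C) (e : X ⟶ I) (m : I ⟶ Y), IsRegularEpi e ∧ Mono m ∧ e ≫ m = f :=
  let F := Regular.strongEpiMonoFactorisation f
  ⟨F.I, F.e, F.m, inferInstanceAs (IsRegularEpi (Regular.strongEpiMonoFactorisation f).e),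
    inferInstance, F.fac⟩

end Regular

/-! ### Consequences of the Short Five Lemma. -/

section Protomodular

variable {C : Type u} [Category.{v} C] [Regular C] [HasZeroMorphisms C] [Protomodular C]

/-- A morphism over `S` between regular epimorphisms onto `S` is a regular epimorphism as soon as
its image contains the kernel of the target. -/
theorem isRegularEpi_of_kernel_lift {E Q S : C} (e : E ⟶ Q) (q : Q ⟶ S) (hq : IsRegularEpi q)
    (h : IsRegularEpi (e ≫ q)) (t : kernel q ⟶ E) (ht : t ≫ e = kernel.ι q) :
    IsRegularEpi e := by
  obtain ⟨I, i, m, hi, hm, hF⟩ := exists_regularEpi_mono_factorization e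
  have hmq : IsRegularEpi (m ≫ q) :=
    isRegularEpi_of_comp i _ (by rwa [← Category.assoc, hF])
  let k := kernel.map (m ≫ q) q m (𝟙 S) (by simp)
  have hk : k ≫ kernel.ι q = kernel.ι (m ≫ q) ≫ m := by simp [k]
  have hkm : Mono k := by
    have : Mono (k ≫ kernel.ι q) := by rw [hk]; infer_instance
    exact mono_of_mono k (kernel.ι q)
  let l : kernel q ⟶ kernel (m ≫ q) :=
    kernel.lift _ (t ≫ i) (by
      rw [Category.assoc, reassoc_of% hF, reassoc_of% ht, kernel.condition])
  have hl : l ≫ k = 𝟙 _ := by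
    rw [← cancel_mono (kernel.ι q)]
    simp [hk, l, hF, ht]
  have : IsSplitEpi k := ⟨⟨⟨l, hl⟩⟩⟩
  have hki : IsIso k := isIso_of_mono_of_isSplitEpi k
  have : IsIso m :=
    Protomodular.shortFive (m ≫ q) q m (𝟙 S) (by simp) hmq hq hki inferInstance
  rw [← hF]
  exact isRegularEpi_comp _ _ hi inferInstance

/-- The regular epimorphism onto the image has zero kernel, so the Short Five Lemma, comparing it
with an identity, makes it invertible. -/
theorem mono_of_kernel_eq_zero {E Q : C} (e : E ⟶ Q)
    (h : ∀ ⦃T : C⦄ (t : T ⟶ E), t ≫ e = 0 → t = 0) : Mono e := by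
  obtain ⟨I, i, m, hi, hm, hF⟩ := exists_regularEpi_mono_factorization e
  have h₀ : kernel.ι i = 0 := h _ (by rw [← hF, kernel.condition_assoc, zero_comp])
  have h₁ : kernel.ι (𝟙 I) = 0 := by simpa using kernel.condition (𝟙 I)
  have hk : IsIso (kernel.map i (𝟙 I) i (𝟙 I) (by simp)) := by
    refine ⟨0, ?_, ?_⟩
    · rw [← cancel_mono (kernel.ι i)]; simp [h₀]
    · rw [← cancel_mono (kernel.ι (𝟙 I))]; simp [h₁]
  have : IsIso i :=
    Protomodular.shortFive i (𝟙 I) i (𝟙 I) (by simp) hi inferInstance hk inferInstance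
  rw [← hF]
  infer_instance

/-- For a morphism `(ε, f)` between split epimorphisms with `ε` and `f` regular epimorphisms, the
comparison with the pullback is a regular epimorphism. -/
theorem isRegularEpi_pullback_lift {E X S A : C} {d : E ⟶ X} {s : X ⟶ E} {d' : S ⟶ A} {s' : A ⟶ S}
    {ε : E ⟶ S} {f : X ⟶ A} (hs : s ≫ d = 𝟙 X) (hd : ε ≫ d' = d ≫ f) (hε : s ≫ ε = f ≫ s')
    (h₁ : IsRegularEpi ε) (h₂ : IsRegularEpi f) :
    IsRegularEpi (pullback.lift ε d hd) := by
  refine isRegularEpi_of_kernel_lift _ (pullback.fst d' f) inferInstance (by simpa using h₁)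
    (kernel.ι _ ≫ pullback.snd _ _ ≫ s) ?_
  apply pullback.hom_ext
  · simp only [Category.assoc, pullback.lift_fst, hε, ← pullback.condition_assoc]
    simp
  · simp [hs]

end Protomodular

/-! ### Direct images of kernel pairs. -/

section SemiAbelian

variable {C : Type u} [Category.{v} C] [HasZeroMorphisms C] [SemiAbelian C]

/-- The direct image of the kernel pair of `h` along a regular epimorphism `f` is the kernel pair
of a regular epimorphism `c`, and `f` maps the kernel of `h` onto the kernel of `c`. -/
theorem exists_quotient_directImage {X Z A : C} (h : X ⟶ Z) (f : X ⟶ A) (hf : IsRegularEpi f) :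
    ∃ (Q : C) (c : A ⟶ Q), IsRegularEpi c ∧
      pullback.fst h h ≫ f ≫ c = pullback.snd h h ≫ f ≫ c ∧
      (∀ ⦃W : C⦄ (m : A ⟶ W), pullback.fst h h ≫ f ≫ m = pullback.snd h h ≫ f ≫ m →
        ∃ m' : Q ⟶ W, c ≫ m' = m) ∧
      ∃ (V : C) (x : V ⟶ X) (w : V ⟶ kernel c), IsRegularEpi w ∧ x ≫ h = 0 ∧
        x ≫ f = w ≫ kernel.ι c := by
  obtain ⟨I, ε, m, hε, hm, hF⟩ := exists_regularEpi_mono_factorization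
    (prod.lift (pullback.fst h h ≫ f) (pullback.snd h h ≫ f))
  let s₀ := m ≫ prod.fst
  let s₁ := m ≫ prod.snd
  have h₀ : ε ≫ s₀ = pullback.fst h h ≫ f := by simp [s₀, reassoc_of% hF]
  have h₁ : ε ≫ s₁ = pullback.snd h h ≫ f := by simp [s₁, reassoc_of% hF]
  have hm' (W : C) (a : W ⟶ I) : a ≫ m = prod.lift (a ≫ s₀) (a ≫ s₁) := by
    ext <;> simp [s₀, s₁]
  have ext (W : C) (a b : W ⟶ I) (ha : a ≫ s₀ = b ≫ s₀) (hb : a ≫ s₁ = b ≫ s₁) : a = b := by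
    rw [← cancel_mono m, hm', hm', ha, hb]
  have lift {W T : C} (e : W ⟶ T) (he : IsRegularEpi e) (g : W ⟶ I) (a b : T ⟶ A)
      (ha : g ≫ s₀ = e ≫ a) (hb : g ≫ s₁ = e ≫ b) :
      ∃ r : T ⟶ I, e ≫ r = g ∧ r ≫ s₀ = a ∧ r ≫ s₁ = b := by
    obtain ⟨r, hr, hr'⟩ := exists_lift_of_isRegularEpi e he m g (prod.lift a b) (by
      rw [hm', ha, hb]; ext <;> simp)
    exact ⟨r, hr, by simp [s₀, reassoc_of% hr'], by simp [s₁, reassoc_of% hr']⟩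
  let Δ : X ⟶ pullback h h := pullback.lift (𝟙 X) (𝟙 X) rfl
  obtain ⟨r, hr, hr₀, hr₁⟩ := lift f hf (Δ ≫ ε) (𝟙 A) (𝟙 A) (by simp [Δ, h₀]) (by simp [Δ, h₁])
  obtain ⟨σ, -, hσ₀, hσ₁⟩ := lift ε hε
    (pullback.lift (pullback.snd h h) (pullback.fst h h) pullback.condition.symm ≫ ε) s₁ s₀
    (by simp [h₀, h₁]) (by simp [h₀, h₁])
  -- Since `e` is a regular epimorphism, a pair in the direct image with first entry `f x` lifts,
  -- after a cover, to a pair in the kernel pair of `h` whose first entry is `x` itself.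
  -- Transitivity rests on this.
  let e : pullback h h ⟶ pullback s₀ f := pullback.lift ε (pullback.fst h h) h₀
  have he : IsRegularEpi e :=
    isRegularEpi_pullback_lift (s := Δ) (s' := r) (by simp [Δ]) h₀ hr.symm hε hf
  have trans : ∃ t : pullback s₁ s₀ ⟶ I, t ≫ s₀ = pullback.fst s₁ s₀ ≫ s₀ ∧
      t ≫ s₁ = pullback.snd s₁ s₀ ≫ s₁ := by
    let e₁ := pullback.fst (pullback.fst s₁ s₀) ε
    let a := pullback.snd (pullback.fst s₁ s₀) ε
    have ha : a ≫ ε = e₁ ≫ pullback.fst s₁ s₀ := pullback.condition.symm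
    let g : _ ⟶ pullback s₀ f := pullback.lift (e₁ ≫ pullback.snd s₁ s₀) (a ≫ pullback.snd h h)
      (by rw [Category.assoc, Category.assoc, ← pullback.condition, ← h₁, reassoc_of% ha])
    let e₂ := pullback.fst g e
    let b := pullback.snd g e
    have hb : e₂ ≫ g = b ≫ e := pullback.condition
    have hb₀ : b ≫ ε = e₂ ≫ e₁ ≫ pullback.snd s₁ s₀ := by
      simpa [g, e] using (congr($hb ≫ pullback.fst s₀ f)).symm
    have hb₁ : b ≫ pullback.fst h h = e₂ ≫ a ≫ pullback.snd h h := by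
      simpa [g, e] using (congr($hb ≫ pullback.snd s₀ f)).symm
    obtain ⟨t, -, ht⟩ := lift (e₂ ≫ e₁) (isRegularEpi_comp _ _ inferInstance inferInstance)
      (pullback.lift (e₂ ≫ a ≫ pullback.fst h h) (b ≫ pullback.snd h h) (by
        rw [Category.assoc, Category.assoc, Category.assoc, ← pullback.condition (f := h),
          reassoc_of% hb₁, pullback.condition]) ≫ ε)
      (pullback.fst s₁ s₀ ≫ s₀) (pullback.snd s₁ s₀ ≫ s₁)
      (by simp [h₀, ← reassoc_of% ha]) (by simp [h₁, ← reassoc_of% hb₀])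
    exact ⟨t, ht⟩
  obtain ⟨t, ht₀, ht₁⟩ := trans
  have heq : EquivalenceRelation s₀ s₁ :=
    { right_cancellation := fun _ a b => ext _ a b
      r := r
      reflexivity₁ := hr₀
      reflexivity₂ := hr₁
      s := σ
      symmetry₁ := hσ₀
      symmetry₂ := hσ₁
      c := pullback.cone s₁ s₀
      isLimit := pullback.isLimit s₁ s₀
      t := t
      transitivity₁ := ht₀
      transitivity₂ := ht₁ }
  obtain ⟨⟨eff⟩⟩ := BarrExact.isEffective s₀ s₁ heq.isEquivalenceRelation
  have hw : s₀ ≫ eff.π = s₁ ≫ eff.π := eff.isKernelPair.w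
  refine ⟨eff.B, eff.π, inferInstance, ?_, fun W m hm => ?_, ?_⟩
  · rw [← reassoc_of% h₀, ← reassoc_of% h₁, hw]
  · exact IsRegularEpi.exists_of_isKernelPair eff.π eff.isKernelPair m (by
      rw [← cancel_epi ε, reassoc_of% h₀, reassoc_of% h₁, hm])
  -- The kernel of the quotient consists of the elements related to `0`; lifting the pair with first
  -- entry `0` along `e` gives a second entry killed by `h`.
  · let α := eff.isKernelPair.lift 0 (kernel.ι eff.π) (by simp)
    have hα₀ : α ≫ s₀ = 0 := eff.isKernelPair.lift_fst _ _ _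
    have hα₁ : α ≫ s₁ = kernel.ι eff.π := eff.isKernelPair.lift_snd _ _ _
    let g : kernel eff.π ⟶ pullback s₀ f := pullback.lift α 0 (by simp [hα₀])
    have hb : pullback.fst g e ≫ g = pullback.snd g e ≫ e := pullback.condition
    have hb₀ : pullback.snd g e ≫ ε = pullback.fst g e ≫ α := by
      simpa [g, e] using (congr($hb ≫ pullback.fst s₀ f)).symm
    have hb₁ : pullback.snd g e ≫ pullback.fst h h = 0 := by
      simpa [g, e] using (congr($hb ≫ pullback.snd s₀ f)).symm
    refine ⟨_, pullback.snd g e ≫ pullback.snd h h, pullback.fst g e, inferInstance, ?_, ?_⟩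
    · rw [Category.assoc, ← pullback.condition, reassoc_of% hb₁, zero_comp]
    · rw [Category.assoc, ← h₁, reassoc_of% hb₀, hα₁]

end SemiAbelian

/-! ### The unit of the reflection. -/

section Birkhoff

variable {C : Type u} [Category.{v} C] (B : ObjectProperty C) [Birkhoff B]

theorem unit_naturality {X A : C} (f : X ⟶ A) :
    f ≫ unit B A = unit B X ≫ B.ι.map ((reflector B.ι).map f) :=
  (reflectorAdjunction B.ι).unit.naturality f

theorem exists_unit_comp_eq {X Y : C} (hY : B Y) (k : X ⟶ Y) : ∃ g, unit B X ≫ g = k := by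
  refine ⟨B.ι.map (((reflectorAdjunction B.ι).homEquiv X ⟨Y, hY⟩).symm k), ?_⟩
  exact ((reflectorAdjunction B.ι).homEquiv_unit ..).symm.trans
    (((reflectorAdjunction B.ι).homEquiv X ⟨Y, hY⟩).apply_symm_apply k)

theorem unit_comp_cancel {X : C} {Y : B.FullSubcategory}
    (g g' : ((reflector B.ι).obj X).obj ⟶ Y.obj)
    (h : unit B X ≫ g = unit B X ≫ g') : g = g' := by
  have : (⟨g⟩ : (reflector B.ι).obj X ⟶ Y) = ⟨g'⟩ := by
    apply ((reflectorAdjunction B.ι).homEquiv X Y).injective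
    rw [Adjunction.homEquiv_unit, Adjunction.homEquiv_unit]
    exact h
  exact congr($(this).hom)

/-- The image of the unit is a subobject of the reflection, so it lies in `B`; the universal
property then splits its inclusion. -/
theorem isRegularEpi_unit [Regular C] (X : C) : IsRegularEpi (unit B X) := by
  obtain ⟨I, i, m, hi, hm, hF⟩ := exists_regularEpi_mono_factorization (unit B X)
  have : B.IsClosedUnderSubobjects := Birkhoff.closedUnderSubobjects
  obtain ⟨g, hg⟩ := exists_unit_comp_eq B
    (B.prop_of_mono m ((reflector B.ι).obj X).property) i
  have hgm : g ≫ m = 𝟙 _ := unit_comp_cancel B _ _ (by rw [reassoc_of% hg, hF]; simp)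
  have : IsSplitEpi m := ⟨⟨⟨g, hgm⟩⟩⟩
  rw [← hF]
  exact isRegularEpi_comp _ _ hi inferInstance

end Birkhoff

/-! ### Commutators and centrality. -/

section Commutator

variable {C : Type u} [Category.{v} C] [HasZeroMorphisms C] [SemiAbelian C]
  (B : ObjectProperty C) [Birkhoff B]

/-- The kernel `[X]` of the unit of the reflection. -/
noncomputable abbrev commutator (X : C) : C := kernel (unit B X)

/-- The inclusion of `[X]` in `X`. -/
noncomputable abbrev commutatorι (X : C) : commutator B X ⟶ X := kernel.ι (unit B X)

/-- The functorial action of `X ↦ [X]`. -/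
noncomputable def commutatorMap {X A : C} (f : X ⟶ A) : commutator B X ⟶ commutator B A :=
  kernel.map _ _ f _ (unit_naturality B f).symm

theorem commutatorMap_ι {X A : C} (f : X ⟶ A) :
    commutatorMap B f ≫ commutatorι B A = commutatorι B X ≫ f := by
  simp [commutatorMap]

theorem commutatorMap_ι_assoc {X A Z : C} (f : X ⟶ A) (g : A ⟶ Z) :
    commutatorMap B f ≫ commutatorι B A ≫ g = commutatorι B X ≫ f ≫ g := by
  rw [← Category.assoc, commutatorMap_ι, Category.assoc]

theorem commutatorι_comp_unit {X A : C} (f : X ⟶ A) :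
    commutatorι B X ≫ f ≫ unit B A = 0 := by
  rw [unit_naturality, kernel.condition_assoc, zero_comp]

/-- The quotient of `A` by the image of `[X]` is a regular quotient of the reflection of `X`, so it
lies in `B`. Hence `[A]` is contained in that image. -/
theorem isRegularEpi_commutatorMap {X A : C} (f : X ⟶ A) (hf : IsRegularEpi f) :
    IsRegularEpi (commutatorMap B f) := by
  obtain ⟨Q, c, hc, hcw, -, V, x, w, hw, hxh, hxf⟩ := exists_quotient_directImage (unit B X) f hf
  have hη := isRegularEpi_unit B X
  obtain ⟨d, hd⟩ := IsRegularEpi.exists_of_isKernelPair (unit B X) (.of_hasPullback _) _ hcw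
  have hdr : IsRegularEpi d :=
    isRegularEpi_of_comp (unit B X) d (by rw [hd]; exact isRegularEpi_comp _ _ hf hc)
  have hQ : B Q := Birkhoff.closedUnderRegularQuotients d hdr ((reflector B.ι).obj X).property
  obtain ⟨g, hg⟩ := exists_unit_comp_eq B hQ c
  let j : commutator B A ⟶ kernel c := kernel.lift c (commutatorι B A) (by
    rw [← hg, kernel.condition_assoc, zero_comp])
  let l : pullback w j ⟶ commutator B X := kernel.lift _ (pullback.fst w j ≫ x) (by simp [hxh])
  apply isRegularEpi_of_comp l
  have : l ≫ commutatorMap B f = pullback.snd w j := by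
    rw [← cancel_mono (commutatorι B A), Category.assoc, commutatorMap_ι, kernel.lift_ι_assoc,
      Category.assoc, hxf, pullback.condition_assoc, kernel.lift_ι]
  rw [this]
  infer_instance

/-- Any two morphisms identified by `f` agree on commutators. For regular epimorphisms this
characterizes central extensions. -/
def EqualizesCommutators {X A : C} (f : X ⟶ A) : Prop :=
  ∀ ⦃W : C⦄ (a b : W ⟶ X), a ≫ f = b ≫ f → commutatorι B W ≫ a = commutatorι B W ≫ b

variable {B}

theorem IsTrivialExtension.equalizesCommutators {X A : C} {f : X ⟶ A}
    (hf : IsTrivialExtension B f) : EqualizesCommutators B f := fun W a b hab =>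
  hf.2.hom_ext (by simp [hab]) (by
    rw [Category.assoc, Category.assoc, commutatorι_comp_unit, commutatorι_comp_unit])

theorem EqualizesCommutators.of_pullback {X A Y : C} {f : X ⟶ A} {g : Y ⟶ A} (hg : IsRegularEpi g)
    (h : EqualizesCommutators B (pullback.snd f g)) : EqualizesCommutators B f := by
  intro W a b hab
  let e := pullback.fst (a ≫ f) g
  have he : e ≫ a ≫ f = pullback.snd (a ≫ f) g ≫ g := pullback.condition
  have key := h (pullback.lift (e ≫ a) (pullback.snd (a ≫ f) g) (by simpa using he))
    (pullback.lift (e ≫ b) (pullback.snd (a ≫ f) g) (by simpa [hab] using he)) (by simp)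
  have hr := isRegularEpi_commutatorMap B e inferInstance
  rw [← cancel_epi (commutatorMap B e), commutatorMap_ι_assoc, commutatorMap_ι_assoc]
  simpa using congr($key ≫ pullback.fst f g)

/-- This is triviality of the second projection of the kernel pair. The comparison is a regular
epimorphism between split epimorphisms' data; its kernel vanishes because both projections agree on
the commutator. -/
theorem EqualizesCommutators.isIso_lift {X A : C} {f : X ⟶ A} (h : EqualizesCommutators B f) :
    IsIso (pullback.lift (unit B (pullback f f)) (pullback.snd f f)
      (unit_naturality B (pullback.snd f f)).symm) := by
  let Δ : X ⟶ pullback f f := pullback.lift (𝟙 X) (𝟙 X) rfl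
  have hΔ : Δ ≫ pullback.snd f f = 𝟙 X := by simp [Δ]
  have := isRegularEpi_pullback_lift (s := Δ) hΔ (unit_naturality B (pullback.snd f f)).symm
    (unit_naturality B Δ) (isRegularEpi_unit B _) (isRegularEpi_unit B X)
  have : Mono (pullback.lift (unit B (pullback f f)) (pullback.snd f f)
      (unit_naturality B (pullback.snd f f)).symm) := by
    refine mono_of_kernel_eq_zero _ fun T t ht => ?_
    have h₁ : t ≫ unit B (pullback f f) = 0 := by simpa using congr($ht ≫ pullback.fst _ _)
    have h₂ : t ≫ pullback.snd f f = 0 := by simpa using congr($ht ≫ pullback.snd _ _)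
    have h₃ : t ≫ pullback.fst f f = t ≫ pullback.snd f f := by
      rw [← kernel.lift_ι _ t h₁, Category.assoc, Category.assoc, h _ _ pullback.condition]
    apply pullback.hom_ext <;> simp [h₃, h₂]
  exact isIso_of_mono_of_strongEpi _

theorem EqualizesCommutators.isCentralExtension {X A : C} {f : X ⟶ A}
    (h : EqualizesCommutators B f) (hf : IsRegularEpi f) : IsCentralExtension B f := by
  refine ⟨hf, X, f, hf, inferInstance, IsPullback.flip ?_⟩
  have := h.isIso_lift
  exact IsPullback.of_iso_pullback ⟨(unit_naturality B (pullback.snd f f)).symm⟩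
    (asIso (pullback.lift _ _ (unit_naturality B (pullback.snd f f)).symm)) (by simp) (by simp)

theorem IsCentralExtension.equalizesCommutators {X A : C} {f : X ⟶ A}
    (hf : IsCentralExtension B f) : EqualizesCommutators B f := by
  obtain ⟨-, Y, g, hg, ht⟩ := hf
  exact .of_pullback hg ht.equalizesCommutators

theorem EqualizesCommutators.comp_mono {U X A : C} {f : X ⟶ A} (h : EqualizesCommutators B f)
    (m : U ⟶ X) [Mono m] : EqualizesCommutators B (m ≫ f) := fun W a b hab => by
  rw [← cancel_mono m]
  simpa using h (a ≫ m) (b ≫ m) (by simpa using hab)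

theorem EqualizesCommutators.pullback_hom_ext {X A T : C} {f : X ⟶ A}
    (h : EqualizesCommutators B f) (a b : T ⟶ pullback f f)
    (h₁ : a ≫ pullback.snd f f = b ≫ pullback.snd f f)
    (h₂ : a ≫ unit B (pullback f f) = b ≫ unit B (pullback f f)) : a = b := by
  have := h.isIso_lift
  rw [← cancel_mono (pullback.lift (unit B (pullback f f)) (pullback.snd f f)
      (unit_naturality B (pullback.snd f f)).symm)]
  apply pullback.hom_ext <;> simp [h₁, h₂]

/-! ### Universal central quotients. -/

variable (B)

/-- Every regular epimorphism has a universal central quotient. -/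
theorem exists_centralization {P A : C} (p : P ⟶ A) (hp : IsRegularEpi p) :
    ∃ (F : C) (c : P ⟶ F) (φ : F ⟶ A), IsRegularEpi c ∧ c ≫ φ = p ∧ EqualizesCommutators B φ ∧
      ∀ ⦃Y : C⦄ (y : Y ⟶ A) (m : P ⟶ Y), EqualizesCommutators B y → m ≫ y = p →
        ∃ m' : F ⟶ Y, c ≫ m' = m := by
  let Δ : P ⟶ pullback p p := pullback.lift (𝟙 P) (𝟙 P) rfl
  -- Pairs over `A` are related when they share their second entry and their class in the
  -- reflection; `F` is the quotient of `P` identifying the first entries of related pairs.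
  let h := prod.lift (pullback.snd p p) (unit B (pullback p p))
  have hh : pullback.fst h h ≫ h = pullback.snd h h ≫ h := pullback.condition
  have hh₁ : pullback.fst h h ≫ pullback.snd p p = pullback.snd h h ≫ pullback.snd p p := by
    simpa [h] using congr($hh ≫ prod.fst)
  have hh₂ : pullback.fst h h ≫ unit B (pullback p p) =
      pullback.snd h h ≫ unit B (pullback p p) := by
    simpa [h] using congr($hh ≫ prod.snd)
  obtain ⟨F, c, hc, hcw, hcu, -⟩ := exists_quotient_directImage h (pullback.fst p p) inferInstance
  obtain ⟨φ, hφ⟩ := hcu p (by rw [pullback.condition, reassoc_of% hh₁])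
  refine ⟨F, c, φ, hc, hφ, fun W a b hab => ?_, fun Y y m hy hm => hcu m ?_⟩
  · let e₁ := pullback.fst a c
    let e₂ := pullback.fst (e₁ ≫ b) c
    let a' := e₂ ≫ pullback.snd a c
    let b' := pullback.snd (e₁ ≫ b) c
    have ha : a' ≫ c = (e₂ ≫ e₁) ≫ a := by simp [a', e₁, pullback.condition]
    have hb : b' ≫ c = (e₂ ≫ e₁) ≫ b := by
      rw [Category.assoc]; exact pullback.condition.symm
    let r : _ ⟶ pullback p p := pullback.lift a' b' (by
      rw [← hφ, reassoc_of% ha, reassoc_of% hb, hab])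
    let k := commutatorι B _ ≫ r
    -- On a commutator the unit vanishes, so `(x, y)` and `(y, y)` are related and `c` identifies
    -- `x` with `y`.
    let z : _ ⟶ pullback h h := pullback.lift k (k ≫ pullback.snd p p ≫ Δ) (by
      apply prod.hom_ext
      · simp [h, Δ]
      · simp only [h, Category.assoc, prod.lift_snd, k, commutatorι_comp_unit]
        simpa using (commutatorι_comp_unit B (r ≫ pullback.snd p p ≫ Δ)).symm)
    have hz := congr(z ≫ $hcw)
    have hr := isRegularEpi_commutatorMap B (e₂ ≫ e₁)
      (isRegularEpi_comp _ _ inferInstance inferInstance)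
    rw [← cancel_epi (commutatorMap B (e₂ ≫ e₁)), commutatorMap_ι_assoc, commutatorMap_ι_assoc,
      ← ha, ← hb]
    simpa [z, k, r, Δ] using hz
  · let n : pullback p p ⟶ pullback y y :=
      pullback.lift (pullback.fst p p ≫ m) (pullback.snd p p ≫ m) (by
        simp [hm, pullback.condition])
    have key := hy.pullback_hom_ext (pullback.fst h h ≫ n) (pullback.snd h h ≫ n)
      (by simp [n, reassoc_of% hh₁])
      (by rw [Category.assoc, Category.assoc, unit_naturality, reassoc_of% hh₂])
    simpa [n] using congr($key ≫ pullback.fst y y)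

/-! ### Perfectness and initiality. -/

variable {B}

/-- If `φ` is central and the restriction of `φ` to `[F]` is still a regular epimorphism, then
`[F]` is its own commutator. -/
theorem EqualizesCommutators.isRegularEpi_commutatorι {F A : C} {φ : F ⟶ A}
    (h : EqualizesCommutators B φ) (hφ : IsRegularEpi (commutatorι B F ≫ φ)) :
    IsRegularEpi (commutatorι B (commutator B F)) := by
  let a := pullback.fst φ (commutatorι B F ≫ φ)
  let b := pullback.snd φ (commutatorι B F ≫ φ)
  -- Here `a` and `b` agree in `F` on commutators, so the regular epimorphism `[a]` onto `[F]`
  -- factors through `[[F]]`.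
  have hab := h a (b ≫ commutatorι B F) (by simpa using pullback.condition)
  have ha := isRegularEpi_commutatorMap B a inferInstance
  have : commutatorMap B b ≫ commutatorι B _ = commutatorMap B a := by
    rw [← cancel_mono (commutatorι B F), Category.assoc, commutatorMap_ι, commutatorMap_ι_assoc,
      hab]
  exact isRegularEpi_of_comp (commutatorMap B b) _ (by rwa [this])

theorem IsPerfect.isIso_commutatorι {X : C} (hX : IsPerfect B X) : IsIso (commutatorι B X) := by
  have h : (⟨0⟩ : (reflector B.ι).obj X ⟶ (reflector B.ι).obj X) = ⟨𝟙 _⟩ := hX.eq_of_src _ _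
  have h' : (0 : ((reflector B.ι).obj X).obj ⟶ _) = 𝟙 _ := congr($(h).hom)
  have h₀ : unit B X = 0 := by
    rw [← Category.comp_id (unit B X), ← h', comp_zero]
  refine ⟨kernel.lift _ (𝟙 X) (by simp [h₀]), ?_, by simp⟩
  rw [← cancel_mono (commutatorι B X)]
  simp

theorem isUniversalCentralExtension_of_unique_lift {U A : C} {u : U ⟶ A}
    (hu : IsCentralExtension B u)
    (h : ∀ ⦃Y : C⦄ (y : Y ⟶ A), IsCentralExtension B y → ∃! g : U ⟶ Y, g ≫ y = u) :
    IsUniversalCentralExtension B u := by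
  refine ⟨hu, ⟨IsInitial.ofUniqueHom
    (fun Y => ⟨Over.homMk (h Y.obj.hom Y.property).choose
      (h Y.obj.hom Y.property).choose_spec.1⟩) fun Y m => ?_⟩⟩
  ext
  exact (h Y.obj.hom Y.property).choose_spec.2 _ (Over.w m.hom)

end Commutator

end UCE

theorem mainTheorem8 {C : Type u} [Category.{v} C] [HasZeroMorphisms C] [UCE.SemiAbelian C]
    [UCE.EnoughRegularProjectives C] (B : ObjectProperty C) [UCE.Birkhoff B]
    {X A : C} (f : X ⟶ A) (hf : UCE.IsCentralExtension B f) (hX : UCE.IsPerfect B X) :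
    ∃ (U : C) (u : U ⟶ A) (q : U ⟶ X),
      UCE.IsUniversalCentralExtension B u ∧ IsRegularEpi q ∧ q ≫ f = u := by
  obtain ⟨P, p, hP, hp⟩ := UCE.EnoughRegularProjectives.presentation X
  obtain ⟨F, c, φ, hc, hφ, hφc, hF⟩ :=
    UCE.exists_centralization B (p ≫ f) (UCE.isRegularEpi_comp _ _ hp hf.1)
  obtain ⟨q, hq⟩ := hF f p hf.equalizesCommutators rfl
  have hqf : q ≫ f = φ := by rw [← cancel_epi c, reassoc_of% hq, hφ]
  have hqr : IsRegularEpi q := UCE.isRegularEpi_of_comp c q (by rwa [hq])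
  have hXi := hX.isIso_commutatorι
  have hr : IsRegularEpi (UCE.commutatorι B F ≫ q) := by
    rw [← UCE.commutatorMap_ι]
    exact UCE.isRegularEpi_comp _ _ (UCE.isRegularEpi_commutatorMap B q hqr) inferInstance
  have hu : IsRegularEpi (UCE.commutatorι B F ≫ φ) := by
    rw [← hqf, ← Category.assoc]
    exact UCE.isRegularEpi_comp _ _ hr hf.1
  refine ⟨_, UCE.commutatorι B F ≫ φ, UCE.commutatorι B F ≫ q, ?_, hr, by simp [hqf]⟩
  refine UCE.isUniversalCentralExtension_of_unique_lift
    ((hφc.comp_mono _).isCentralExtension hu) fun Y y hy => ?_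
  obtain ⟨m, hm⟩ := hP y (p ≫ f) hy.1
  obtain ⟨m', hm'⟩ := hF y m hy.equalizesCommutators hm
  have hmy : m' ≫ y = φ := by rw [← cancel_epi c, reassoc_of% hm', hm, hφ]
  refine ⟨UCE.commutatorι B F ≫ m', by simp [hmy], fun g hg => ?_⟩
  have hκ := hφc.isRegularEpi_commutatorι hu
  rw [← cancel_epi (UCE.commutatorι B _)]
  exact hy.equalizesCommutators _ _ (by simp [hg, hmy])
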